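/- Let $M$ be a loopless matroid on a nonempty finite ground set $E$ (every element of $E$ lies in some basis), of rank $k$ and size $n=|E|$, and let $\rho(M)=n/k$ be its density. Call $M$ \emph{strictly uniformly dense} if the constant point $(\rho(M)^{-1},\dots,\rho(M)^{-1})\in\mathbb{R}^E$ lies in the relative interior of the base polytope $P(M)=\operatorname{conv}\{e_B : B \text{ is a basis of } M\}$, where $e_B$ is the $0$--$1$ indicator vector of $B$. Call $M$ \emph{real representable} if there is a real $k\times n$ matrix $X$ of rank $k$, with columns indexed by $E$, such that a $k$-element subset $B\subseteq E$ is a basis of $M$ if and only if $\det(X_B)\neq 0$, where $X_B$ is the submatrix of the columns in $B$. A \emph{projection representation} of $M$ is a real symmetric matrix $T$ with rows and columns indexed by $E$ such that $T^2=T$ and such that a $k$-element subset $B\subseteq E$ is a basis of $M$ if and only if the principal submatrix $T_{BB}$ is non-singular. \textbf{Theorem.} Let $M$ be a real representable matroid as above. Then $M$ is strictly uniformly dense if and only if $M$ has a projection representation $T$ with constant diagonal $T_{ee}=\rho(M)^{-1}$ for all $e\in E$. -/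

import Mathlib

namespace UniformlyDense

/-- The rank of a matroid (the common cardinality of its bases), as a natural number.
It is only used for matroids with a finite ground set. -/
noncomputable def rk {E : Type*} (M : Matroid E) : ℕ :=
  M.eRank.toNat

/-- The density `ρ(M) = |E| / rank(M)` of a matroid with a finite ground set. -/
noncomputable def density {E : Type*} (M : Matroid E) : ℝ :=
  (M.E.ncard : ℝ) / (rk M : ℝ)

/-- The base polytope: the convex hull in `ℝ^E` of the `0`-`1` indicator vectors of the bases. -/
noncomputable def basePolytope {E : Type*} (M : Matroid E) : Set (E → ℝ) :=
  convexHull ℝ {x : E → ℝ | ∃ B : Set E, M.IsBase B ∧ x = B.indicator (fun _ => (1 : ℝ))}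

/-- A matroid is strictly uniformly dense if the constant point `(ρ⁻¹, …, ρ⁻¹)` lies in the
relative interior of its base polytope. -/
def IsStrictlyUniformlyDense {E : Type*} (M : Matroid E) : Prop :=
  (fun _ : E => (density M)⁻¹) ∈ intrinsicInterior ℝ (basePolytope M)

/-- A real `k × n` matrix `X` of full rank, with `k = rank(M)` and columns indexed by the ground
set, represents `M` if a `k`-element set `B` is a basis exactly when the maximal minor `det X_B`
is nonzero. The embedding `f` enumerates the columns in `B`; its order only affects the sign. -/
def IsRealRepresentation {E : Type*} [Fintype E] (M : Matroid E)
    (X : Matrix (Fin (rk M)) E ℝ) : Prop :=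
  X.rank = rk M ∧
    ∀ f : Fin (rk M) ↪ E, M.IsBase (Set.range f) ↔ (X.submatrix id f).det ≠ 0

/-- A matroid is real representable if it has a real representation. -/
def IsRealRepresentable {E : Type*} [Fintype E] (M : Matroid E) : Prop :=
  ∃ X : Matrix (Fin (rk M)) E ℝ, IsRealRepresentation M X

/-- A real matrix is an orthogonal projection matrix if it is symmetric and idempotent. -/
def IsOrthogonalProjection {E : Type*} [Fintype E] (T : Matrix E E ℝ) : Prop :=
  T.IsSymm ∧ T * T = T

/-- An orthogonal projection matrix `T` is a projection representation of `M` if a set `B` with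
`rank(M)` elements is a basis exactly when the principal submatrix `T_{BB}` is non-singular. -/
def IsProjectionRepresentation {E : Type*} [Fintype E] [DecidableEq E] (M : Matroid E)
    (T : Matrix E E ℝ) : Prop :=
  IsOrthogonalProjection T ∧
    ∀ B : Finset E, B.card = rk M →
      (M.IsBase (B : Set E) ↔
        (T.submatrix (fun b : {e // e ∈ B} => (b : E)) (fun b : {e // e ∈ B} => (b : E))).det ≠ 0)

end UniformlyDense

open scoped Matrix Nat Topology

/-! Weight each choice of k columns of a real k × n matrix `Y` by its squared minor. Cauchy-Binet
makes these weights a probability measure on bases after normalisation, and its marginal at `e` is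
the diagonal entry `T e e` of the projection `T` onto the row space of `Y`. The principal minors of
`T` are the same normalised weights, so `T` represents the matroid of `Y`.

A projection with constant diagonal therefore writes the constant point as a combination of all base
vertices with positive coefficients, which characterises the relative interior. Conversely, scaling
column `e` of a representation by `exp (y e / 2)` keeps the bases and tilts the weights
exponentially. Every relative interior point is the mean of some tilting, because the
log-partition-type function attains its minimum; `exists_exponential_tilting` supplies this `y`. -/

namespace UniformlyDense

/-! ### Cauchy-Binet and determinantal marginals -/

/-- Expansion of the determinant of a product along the rows of the first factor. -/
theorem det_mul_eq_sum_prod_mul_det {R m n : Type*} [CommRing R] [Fintype m] [DecidableEq m]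
    [Fintype n] (A : Matrix m n R) (B : Matrix n m R) :
    (A * B).det = ∑ f : m → n, (∏ i, A i (f i)) * (B.submatrix f id).det := by
  classical
  have h : A * B = fun i => ∑ e, A i e • B e := by
    ext i j
    simp [Matrix.mul_apply, Finset.sum_apply]
  have key := (Matrix.detRowAlternating (n := m) (R := R)).toMultilinearMap.map_sum
    (fun i e => A i e • B e)
  rw [h]
  refine key.trans (Finset.sum_congr rfl fun f _ => ?_)
  exact (Matrix.detRowAlternating (n := m) (R := R)).toMultilinearMap.map_smul_univ
    (fun i => A i (f i)) (fun i => B (f i))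

/-- The Cauchy-Binet formula, with the sum over all maps from the rows to the columns. -/
theorem factorial_mul_det_mul {R m n : Type*} [CommRing R] [Fintype m] [DecidableEq m]
    [Fintype n] (A : Matrix m n R) (B : Matrix n m R) :
    ((Fintype.card m)! : R) * (A * B).det
      = ∑ f : m → n, (A.submatrix id f).det * (B.submatrix f id).det := by
  classical
  -- Permuting rows costs the sign of `σ`, which the second determinant repays after reindexing `f`;
  -- averaging over `σ` then turns the product into a determinant.
  have h : ∀ σ : Equiv.Perm m, ∑ f : m → n,
      (Equiv.Perm.sign σ : R) * (∏ i, A (σ i) (f i)) * (B.submatrix f id).det = (A * B).det := by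
    intro σ
    rw [det_mul_eq_sum_prod_mul_det,
      ← Equiv.sum_comp (Equiv.arrowCongr σ.symm (Equiv.refl n))]
    refine Finset.sum_congr rfl fun f _ => ?_
    have h1 : B.submatrix (Equiv.arrowCongr σ.symm (Equiv.refl n) f) id
        = (B.submatrix f id).submatrix σ id := by
      ext i j; simp
    have h2 : ∏ i, A (σ i) (Equiv.arrowCongr σ.symm (Equiv.refl n) f i) = ∏ i, A i (f i) := by
      simpa using Equiv.prod_comp σ (fun i => A i (f i))
    rw [h1, h2, Matrix.det_permute]
    have h3 : ((Equiv.Perm.sign σ : ℤ) : R) * ((Equiv.Perm.sign σ : ℤ) : R) = 1 := by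
      rw [← Int.cast_mul, Int.units_coe_mul_self, Int.cast_one]
    linear_combination (∏ i, A i (f i)) * (B.submatrix f id).det * h3
  calc ((Fintype.card m)! : R) * (A * B).det
      = ∑ σ : Equiv.Perm m, ∑ f : m → n,
        (Equiv.Perm.sign σ : R) * (∏ i, A (σ i) (f i)) * (B.submatrix f id).det := by
        simp [h, Fintype.card_perm]
    _ = _ := by
        rw [Finset.sum_comm]
        refine Finset.sum_congr rfl fun f _ => ?_
        rw [← Finset.sum_mul, Matrix.det_apply' (A.submatrix id f)]
        rfl

/-- Cauchy-Binet for a weighted Gram matrix. -/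
theorem factorial_mul_det_gram {R m n : Type*} [CommRing R] [Fintype m] [DecidableEq m]
    [Fintype n] [DecidableEq n] (Y : Matrix m n R) (u : n → R) :
    ((Fintype.card m)! : R) * (Y * Matrix.diagonal u * Yᵀ).det
      = ∑ f : m → n, (∏ i, u (f i)) * (Y.submatrix id f).det ^ 2 := by
  rw [factorial_mul_det_mul]
  refine Finset.sum_congr rfl fun f _ => ?_
  have h1 : (Y * Matrix.diagonal u).submatrix id f
      = Matrix.of fun i j => u (f j) * Y.submatrix id f i j := by
    ext i j; simp [mul_comm]
  have h2 : Yᵀ.submatrix f id = (Y.submatrix id f)ᵀ := rfl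
  rw [h1, h2, Matrix.det_mul_row, Matrix.det_transpose]
  ring

/-- The diagonal entries of the projection onto the row space of `Y` are the marginals of the
determinantal measure given by the squared maximal minors of `Y`. -/
theorem factorial_mul_det_mul_projection_diag {m n : Type*} [Fintype m] [DecidableEq m]
    [Fintype n] [DecidableEq n] (Y : Matrix m n ℝ) (hY : (Y * Yᵀ).det ≠ 0) (e : n) :
    ((Fintype.card m)! : ℝ) * (Y * Yᵀ).det * (Yᵀ * (Y * Yᵀ)⁻¹ * Y) e e
      = ∑ f : m → n, (∑ i, if f i = e then 1 else 0) * (Y.submatrix id f).det ^ 2 := by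
  have h1 := factorial_mul_det_gram Y (fun _ => 1)
  have h2 := factorial_mul_det_gram Y (fun x => 1 + if x = e then 1 else 0)
  have h3 : Y * Matrix.diagonal (fun x => (1 : ℝ) + if x = e then 1 else 0) * Yᵀ
      = Y * Yᵀ + Matrix.replicateCol Unit (fun i => Y i e)
        * Matrix.replicateRow Unit (fun i => Y i e) := by
    ext i j
    rw [Matrix.mul_apply]
    simp only [Matrix.mul_diagonal]
    simp [Matrix.mul_apply, mul_add, add_mul, Finset.sum_add_distrib]
  have h4 : (Matrix.replicateRow Unit (fun i => Y i e) * (Y * Yᵀ)⁻¹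
      * Matrix.replicateCol Unit (fun i => Y i e)) () () = (Yᵀ * (Y * Yᵀ)⁻¹ * Y) e e := by
    simp [Matrix.mul_apply]
  rw [h3, Matrix.det_add_replicateCol_mul_replicateRow (isUnit_iff_ne_zero.2 hY)] at h2
  have h5 : (1 + Matrix.replicateRow Unit (fun i => Y i e) * (Y * Yᵀ)⁻¹
      * Matrix.replicateCol Unit (fun i => Y i e)).det = 1 + (Yᵀ * (Y * Yᵀ)⁻¹ * Y) e e := by
    rw [Matrix.det_unique, Matrix.add_apply, ← h4]
    simp
  rw [h5] at h2
  simp only [Matrix.diagonal_one, Matrix.mul_one, Finset.prod_const_one, one_mul] at h1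
  have h6 : ∀ f : m → n, (∏ i, ((1 : ℝ) + if f i = e then 1 else 0)) * (Y.submatrix id f).det ^ 2
      = (Y.submatrix id f).det ^ 2
        + (∑ i, if f i = e then 1 else 0) * (Y.submatrix id f).det ^ 2 := by
    intro f
    -- An injective `f` hits `e` at most once, so the product is linear in the hits; otherwise the
    -- minor vanishes.
    by_cases hf : Function.Injective f
    · by_cases he : ∃ i, f i = e
      · obtain ⟨i, rfl⟩ := he
        simp only [hf.eq_iff]
        rw [Finset.prod_eq_single i (by intros; simp_all) (by simp),
          Finset.sum_eq_single i (by intros; simp_all) (by simp)]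
        simp; ring
      · push Not at he
        simp [he]
    · have : (Y.submatrix id f).det = 0 := by
        rw [Function.not_injective_iff] at hf
        obtain ⟨i, j, hij, hne⟩ := hf
        exact Matrix.det_zero_of_column_eq hne fun k => by simp [hij]
      simp [this]
  rw [Finset.sum_congr rfl fun f _ => h6 f, Finset.sum_add_distrib] at h2
  linear_combination h2 - h1

/-! ### Projections onto row spaces -/

theorem isOrthogonalProjection_of_det_ne_zero {m n : Type*} [Fintype m] [DecidableEq m]
    [Fintype n] (Y : Matrix m n ℝ) (hY : (Y * Yᵀ).det ≠ 0) :
    IsOrthogonalProjection (Yᵀ * (Y * Yᵀ)⁻¹ * Y) := by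
  constructor
  · simp [Matrix.IsSymm, Matrix.transpose_mul, Matrix.transpose_nonsing_inv, Matrix.mul_assoc]
  · calc Yᵀ * (Y * Yᵀ)⁻¹ * Y * (Yᵀ * (Y * Yᵀ)⁻¹ * Y)
        = Yᵀ * ((Y * Yᵀ)⁻¹ * (Y * Yᵀ)) * ((Y * Yᵀ)⁻¹ * Y) := by simp only [Matrix.mul_assoc]
      _ = Yᵀ * (Y * Yᵀ)⁻¹ * Y := by
        rw [Matrix.nonsing_inv_mul _ (isUnit_iff_ne_zero.2 hY), Matrix.mul_one, Matrix.mul_assoc]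

/-- A projection is determined by spanning rows: if `Y` consists of rows of an orthogonal
projection `T` whose trace is the number of these rows, and the Gram matrix of `Y` is
non-singular, then `T` is the projection onto the row space of `Y`. -/
theorem eq_projection_of_mul_eq {m n : Type*} [Fintype m] [DecidableEq m]
    [Fintype n] [DecidableEq n] (T : Matrix n n ℝ) (hT : IsOrthogonalProjection T)
    (Y : Matrix m n ℝ) (hYT : Y * T = Y) (hY : (Y * Yᵀ).det ≠ 0)
    (htr : T.trace = Fintype.card m) : T = Yᵀ * (Y * Yᵀ)⁻¹ * Y := by
  obtain ⟨hs, hi⟩ := hT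
  set P := Yᵀ * (Y * Yᵀ)⁻¹ * Y with hP
  have hu : IsUnit (Y * Yᵀ).det := isUnit_iff_ne_zero.2 hY
  have hPs : Pᵀ = P := (isOrthogonalProjection_of_det_ne_zero Y hY).1
  have hPT : P * T = P := by rw [hP, Matrix.mul_assoc, hYT]
  have hTP : T * P = P := by
    have := congrArg Matrix.transpose hPT
    rwa [Matrix.transpose_mul, hPs, hs.eq] at this
  have hPP : P * P = P := (isOrthogonalProjection_of_det_ne_zero Y hY).2
  have hPtr : P.trace = Fintype.card m := by
    rw [hP, Matrix.mul_assoc, Matrix.trace_mul_comm, Matrix.mul_assoc,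
      Matrix.nonsing_inv_mul _ hu, Matrix.trace_one]
  -- Since `TP = PT = P`, the product collapses to `T - P`, whose trace is zero.
  have h0 : ((T - P)ᵀ * (T - P)).trace = 0 := by
    rw [Matrix.transpose_sub, hPs, hs.eq, sub_mul, mul_sub, mul_sub, hi, hTP, hPT, hPP]
    simp [htr, hPtr]
  rw [← sub_eq_zero]
  have := (Matrix.trace_conjTranspose_mul_self_eq_zero_iff (A := T - P)).1
    (by rwa [Matrix.conjTranspose_eq_transpose_of_trivial])
  exact this

/-! ### Relative interiors of polytopes -/

/-- The relative interior of a polytope consists of the convex combinations of its generators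
with positive coefficients. -/
theorem mem_intrinsicInterior_convexHull_range_iff {ι V : Type*} [Fintype ι] [Nonempty ι]
    [NormedAddCommGroup V] [NormedSpace ℝ V] [FiniteDimensional ℝ V] (v : ι → V) (c : V) :
    c ∈ intrinsicInterior ℝ (convexHull ℝ (Set.range v)) ↔
      ∃ p : ι → ℝ, (∀ i, 0 < p i) ∧ ∑ i, p i = 1 ∧ ∑ i, p i • v i = c := by
  have hull : ∀ x, x ∈ convexHull ℝ (Set.range v) ↔
      ∃ p : ι → ℝ, (∀ i, 0 ≤ p i) ∧ ∑ i, p i = 1 ∧ ∑ i, p i • v i = x := by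
    intro x
    constructor
    · intro hx
      have : convexHull ℝ (Set.range v) ⊆
          {x | ∃ p : ι → ℝ, (∀ i, 0 ≤ p i) ∧ ∑ i, p i = 1 ∧ ∑ i, p i • v i = x} := by
        classical
        refine convexHull_min ?_ ?_
        · rintro _ ⟨i, rfl⟩
          refine ⟨Pi.single i 1, fun j => ?_, by simp, ?_⟩
          · by_cases h : j = i
            · subst h; simp
            · simp [h]
          · simp [Pi.single_apply, ite_smul]
        · rintro _ ⟨p, hp0, hp1, rfl⟩ _ ⟨q, hq0, hq1, rfl⟩ s t hs ht hst
          refine ⟨fun i => s * p i + t * q i, fun i => ?_, ?_, ?_⟩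
          · have := hp0 i
            have := hq0 i
            positivity
          · rw [Finset.sum_add_distrib, ← Finset.mul_sum, ← Finset.mul_sum, hp1, hq1]
            linarith
          · simp [add_smul, Finset.sum_add_distrib, Finset.smul_sum, mul_smul]
      exact this hx
    · rintro ⟨p, hp0, hp1, rfl⟩
      exact (convex_convexHull ℝ _).sum_mem (fun i _ => hp0 i) hp1
        fun i _ => subset_convexHull ℝ _ ⟨i, rfl⟩
  have hN : (0 : ℝ) < Fintype.card ι := by exact_mod_cast Fintype.card_pos
  set S := affineSpan ℝ (convexHull ℝ (Set.range v)) with hS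
  constructor
  · rw [mem_intrinsicInterior]
    rintro ⟨y, hy, rfl⟩
    set m : V := ∑ i, (Fintype.card ι : ℝ)⁻¹ • v i with hm
    have hmem : m ∈ S := subset_affineSpan ℝ _ ((hull m).2
      ⟨fun _ => (Fintype.card ι : ℝ)⁻¹, fun _ => by positivity, by simp [hN.ne'], rfl⟩)
    -- The ray leaves `y` away from the barycenter `m`; a point slightly beyond `y`, averaged back
    -- with `m`, gives `y` positive coefficients.
    let γ : ℝ → S := fun t => ⟨AffineMap.lineMap (y : V) m (-t), AffineMap.lineMap_mem _ y.2 hmem⟩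
    have hγ : Continuous γ := by
      refine Continuous.subtype_mk ?_ _
      simp only [AffineMap.lineMap_apply]
      fun_prop
    have hγ0 : γ 0 = y := by ext; simp [γ]
    have hev : ∀ᶠ t in 𝓝[>] (0 : ℝ), (γ t : V) ∈ convexHull ℝ (Set.range v) := by
      refine Filter.Eventually.filter_mono nhdsWithin_le_nhds ?_
      have h := mem_interior_iff_mem_nhds.1 hy
      rw [← hγ0] at h
      exact hγ.continuousAt.eventually_mem h
    obtain ⟨t, ht, ht0⟩ := (hev.and self_mem_nhdsWithin).exists
    replace ht0 : 0 < t := ht0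
    obtain ⟨q, hq0, hq1, hq⟩ := (hull _).1 ht
    refine ⟨fun i => (q i + t * (Fintype.card ι : ℝ)⁻¹) / (1 + t), fun i => ?_, ?_, ?_⟩
    · have := hq0 i
      positivity
    · rw [← Finset.sum_div, Finset.sum_add_distrib, hq1]
      simp
      field_simp
    · have h1 : (1 + t) • (y : V) = (γ t : V) + t • m := by
        simp only [γ, AffineMap.lineMap_apply, vsub_eq_sub, vadd_eq_add]
        module
      have h2 : (y : V) = (1 + t)⁻¹ • ((γ t : V) + t • m) := by
        rw [← h1, smul_smul, inv_mul_cancel₀ (by positivity), one_smul]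
      rw [h2, ← hq, hm, Finset.smul_sum, ← Finset.sum_add_distrib, Finset.smul_sum]
      refine Finset.sum_congr rfl fun i _ => ?_
      rw [smul_smul, ← add_smul, smul_smul]
      congr 1
      field_simp
  · rintro ⟨p, hp0, hp1, hpc⟩
    have hc : c ∈ S := subset_affineSpan ℝ _ ((hull c).2 ⟨p, fun i => (hp0 i).le, hp1, hpc⟩)
    rw [mem_intrinsicInterior]
    refine ⟨⟨c, hc⟩, ?_, rfl⟩
    rw [mem_interior_iff_mem_nhds]
    let L : (ι → ℝ) →ₗ[ℝ] V × ℝ :=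
      (∑ i, (LinearMap.proj i).smulRight (v i)).prod (∑ i, LinearMap.proj i)
    have hL : ∀ a, L a = (∑ i, a i • v i, ∑ i, a i) := by
      intro a; simp [L]
    obtain ⟨g, hg⟩ := L.rangeRestrict.exists_rightInverse_of_surjective L.range_rangeRestrict
    have hSL : ∀ q : S, ((q : V), (1 : ℝ)) ∈ LinearMap.range L := by
      rintro ⟨q, hq⟩
      rw [hS, affineSpan_convexHull] at hq
      obtain ⟨w, hw, hqw⟩ := eq_affineCombination_of_mem_affineSpan_of_fintype hq
      rw [Finset.affineCombination_eq_linear_combination _ _ _ hw] at hqw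
      exact ⟨w, by rw [hL, hw, ← hqw]⟩
    -- A linear section of `L` corrects `p` continuously as the point moves; `G` equals `p` at `c`,
    -- so it stays positive nearby.
    let G : S → ι → ℝ := fun q => p + g ⟨_, hSL q⟩ - g ⟨_, hSL ⟨c, hc⟩⟩
    have hG : Continuous G := by
      have : Continuous g := g.continuous_of_finiteDimensional
      have h2 : Continuous fun q : S => (⟨_, hSL q⟩ : LinearMap.range L) :=
        Continuous.subtype_mk (by fun_prop) _
      exact (continuous_const.add (this.comp h2)).sub continuous_const
    have hGL : ∀ q : S, L (G q) = ((q : V), 1) := by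
      intro q
      have h1 : ∀ z, L (g z) = z := fun z => congrArg Subtype.val (LinearMap.congr_fun hg z)
      simp only [G, map_sub, map_add, h1]
      rw [hL, hp1, hpc]
      simp
    have hev : ∀ᶠ q in 𝓝 (⟨c, hc⟩ : S), ∀ i, 0 < G q i := by
      rw [Filter.eventually_all]
      intro i
      refine ((continuous_apply i).comp hG).continuousAt.eventually (lt_mem_nhds ?_)
      simpa [G] using hp0 i
    filter_upwards [hev] with q hq
    have := hGL q
    rw [hL, Prod.mk.injEq] at this
    exact (hull _).2 ⟨G q, fun i => (hq i).le, this.2, this.1⟩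

/-! ### Exponential tilting -/

/-- A point with a positive representation as a convex combination of the points `v i` is the
mean of an exponential tilting of any positive weight on these points. -/
theorem exists_exponential_tilting {ι E : Type*} [Fintype ι] [Fintype E] (v : ι → E → ℝ)
    (c : E → ℝ) (a p : ι → ℝ) (ha : ∀ i, 0 < a i) (hp : ∀ i, 0 < p i) (hp1 : ∑ i, p i = 1)
    (hpc : ∑ i, p i • v i = c) :
    ∃ y : E → ℝ, ∀ e, ∑ i, a i * Real.exp (∑ x, v i x * y x) * (v i e - c e) = 0 := by
  classical
  let L : (E → ℝ) →ₗ[ℝ] (ι → ℝ) := Matrix.mulVecLin (Matrix.of fun i e => v i e - c e)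
  have hL : ∀ y i, L y i = ∑ e, (v i e - c e) * y e := fun y i => rfl
  let F : (ι → ℝ) → ℝ := fun x => ∑ i, a i * Real.exp (x i)
  have hF : Continuous F := by fun_prop
  have hterm : ∀ x i, a i * Real.exp (x i) ≤ F x := fun x i =>
    Finset.single_le_sum (f := fun i => a i * Real.exp (x i))
      (fun j _ => (mul_pos (ha j) (Real.exp_pos _)).le) (Finset.mem_univ i)
  have hlog : ∀ i, 0 ≤ Real.log (F 0 / a i) := by
    intro i
    refine Real.log_nonneg ((one_le_div (ha i)).2 ?_)
    simpa using hterm 0 i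
  let r : ℝ := ∑ i, Real.log (F 0 / a i)
  have hr0 : 0 ≤ r := Finset.sum_nonneg fun i _ => hlog i
  have hup : ∀ x, F x ≤ F 0 → ∀ i, x i ≤ r := by
    intro x hx i
    refine le_trans ?_ (Finset.single_le_sum (fun j _ => hlog j) (Finset.mem_univ i))
    have h1 : Real.exp (x i) ≤ F 0 / a i := by
      rw [le_div_iff₀ (ha i), mul_comm]
      exact (hterm x i).trans hx
    simpa using Real.log_le_log (Real.exp_pos _) h1
  -- The weights `p` balance every vector in the range of `L`, so the upper bounds on a sublevel set
  -- force lower bounds and give compactness.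
  have hbal : ∀ x ∈ LinearMap.range L, ∑ i, p i * x i = 0 := by
    rintro _ ⟨y, rfl⟩
    simp only [hL, Finset.mul_sum]
    rw [Finset.sum_comm]
    refine Finset.sum_eq_zero fun e _ => ?_
    have := congrFun hpc e
    simp only [Finset.sum_apply, Pi.smul_apply, smul_eq_mul] at this
    calc ∑ i, p i * ((v i e - c e) * y e)
        = (∑ i, p i * v i e - (∑ i, p i) * c e) * y e := by
          rw [Finset.sum_mul, ← Finset.sum_sub_distrib, Finset.sum_mul]
          exact Finset.sum_congr rfl fun i _ => by ring
      _ = 0 := by rw [this, hp1]; ring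
  have hlow : ∀ x ∈ LinearMap.range L, F x ≤ F 0 → ∀ i, -(r / p i) ≤ x i := by
    intro x hxL hx i
    have h1 : ∑ j, p j * (r - x j) = r := by
      simp only [mul_sub, Finset.sum_sub_distrib, hbal x hxL, ← Finset.sum_mul, hp1]
      ring
    have h2 : p i * (r - x i) ≤ r := le_of_le_of_eq (Finset.single_le_sum
      (f := fun j => p j * (r - x j))
      (fun j _ => mul_nonneg (hp j).le (sub_nonneg.2 (hup x hx j)))
      (Finset.mem_univ i)) h1
    have h3 : -r ≤ p i * x i := by nlinarith [mul_nonneg (hp i).le hr0]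
    rw [← neg_div, div_le_iff₀ (hp i)]
    linarith
  let K : Set (ι → ℝ) := (LinearMap.range L : Set (ι → ℝ)) ∩
    Set.univ.pi fun i => Set.Icc (-(r / p i)) r
  have hK : IsCompact K := (isCompact_univ_pi fun i => isCompact_Icc).inter_left
    (Submodule.closed_of_finiteDimensional _)
  have h0K : (0 : ι → ℝ) ∈ K := by
    refine ⟨Submodule.zero_mem _, fun i _ => ⟨?_, hr0⟩⟩
    exact neg_nonpos.2 (div_nonneg hr0 (hp i).le)
  obtain ⟨x, hxK, hmin⟩ := hK.exists_isMinOn ⟨0, h0K⟩ hF.continuousOn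
  obtain ⟨y, rfl⟩ := hxK.1
  have hglob : ∀ z, F (L y) ≤ F (L z) := by
    intro z
    by_cases hz : F (L z) ≤ F 0
    · exact hmin (show L z ∈ K from ⟨⟨z, rfl⟩, fun i _ =>
        ⟨hlow _ ⟨z, rfl⟩ hz i, hup _ hz i⟩⟩)
    · exact (hmin h0K).trans (not_le.1 hz).le
  refine ⟨y, fun e => ?_⟩
  have hline : ∀ t : ℝ, F (L (y + t • Pi.single e 1))
      = ∑ i, a i * Real.exp (L y i + t * (v i e - c e)) := by
    intro t
    simp only [F, map_add, map_smul]
    refine Finset.sum_congr rfl fun i _ => ?_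
    simp [L]
  have hd : HasDerivAt (fun t : ℝ => F (L (y + t • Pi.single e 1)))
      (∑ i, a i * Real.exp (L y i) * (v i e - c e)) 0 := by
    simp only [hline]
    refine HasDerivAt.fun_sum fun i _ => ?_
    have h1 : HasDerivAt (fun t : ℝ => L y i + t * (v i e - c e)) (v i e - c e) 0 := by
      simpa using ((hasDerivAt_id (0 : ℝ)).mul_const (v i e - c e)).const_add (L y i)
    simpa [mul_assoc] using h1.exp.const_mul (a i)
  have hz : ∑ i, a i * Real.exp (L y i) * (v i e - c e) = 0 := by
    refine IsLocalMin.hasDerivAt_eq_zero (Filter.Eventually.of_forall fun t => ?_) hd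
    rw [zero_smul, add_zero]
    exact hglob _
  -- Exponents in `L` are centred at `c`; undoing this costs a factor independent of `i`.
  have hexp : ∀ i, Real.exp (∑ x, v i x * y x) = Real.exp (L y i) * Real.exp (∑ x, c x * y x) := by
    intro i
    rw [← Real.exp_add, hL, ← Finset.sum_add_distrib]
    exact congrArg _ (Finset.sum_congr rfl fun x _ => by ring)
  calc ∑ i, a i * Real.exp (∑ x, v i x * y x) * (v i e - c e)
      = (∑ i, a i * Real.exp (L y i) * (v i e - c e)) * Real.exp (∑ x, c x * y x) := by
        rw [Finset.sum_mul]
        exact Finset.sum_congr rfl fun i _ => by rw [hexp]; ring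
    _ = 0 := by rw [hz, zero_mul]

/-! ### Bases as maps with nonzero minor -/

theorem injective_of_det_submatrix_ne_zero {m n : Type*} [Fintype m] [DecidableEq m]
    (X : Matrix m n ℝ) (f : m → n) (h : (X.submatrix id f).det ≠ 0) : Function.Injective f := by
  intro i j hij
  by_contra hne
  exact h (Matrix.det_zero_of_column_eq hne fun k => by simp [hij])

theorem det_submatrix_projection {m n : Type*} [Fintype m] [DecidableEq m]
    [Fintype n] (Y : Matrix m n ℝ) (f : m → n) :
    ((Yᵀ * (Y * Yᵀ)⁻¹ * Y).submatrix f f).det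
      = (Y.submatrix id f).det ^ 2 * ((Y * Yᵀ).det)⁻¹ := by
  have h : (Yᵀ * (Y * Yᵀ)⁻¹ * Y).submatrix f f
      = (Y.submatrix id f)ᵀ * (Y * Yᵀ)⁻¹ * Y.submatrix id f := rfl
  rw [h, Matrix.det_mul, Matrix.det_mul, Matrix.det_transpose, Matrix.det_nonsing_inv,
    Ring.inverse_eq_inv']
  ring

theorem sum_subtype_eq_sum_of_ne_zero {ι : Type*} [Fintype ι] (P : ι → Prop) [DecidablePred P]
    (F : ι → ℝ) (h : ∀ f, F f ≠ 0 → P f) : ∑ f : {f // P f}, F f = ∑ f, F f := by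
  rw [← Finset.sum_filter_of_ne (fun f _ hf => h f hf)]
  exact (Finset.sum_subtype _ (by simp) F).symm

/-- The vector counting how often `f` takes each value. -/
def countVector {m n : Type*} [Fintype m] [DecidableEq n] (f : m → n) : n → ℝ :=
  fun e => ∑ i, if f i = e then 1 else 0

theorem countVector_eq_indicator {m n : Type*} [Fintype m] [DecidableEq n] {f : m → n}
    (hf : Function.Injective f) :
    countVector f = (Set.range f).indicator fun _ => (1 : ℝ) := by
  classical
  funext e
  by_cases he : e ∈ Set.range f
  · rw [Set.indicator_of_mem he]
    obtain ⟨i, rfl⟩ := he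
    simp [countVector, hf.eq_iff]
  · rw [Set.indicator_of_notMem he]
    refine Finset.sum_eq_zero fun i _ => if_neg fun h => he ⟨i, h⟩

theorem sum_countVector_mul {m n : Type*} [Fintype m] [Fintype n] [DecidableEq n] (f : m → n)
    (y : n → ℝ) : ∑ e, countVector f e * y e = ∑ i, y (f i) := by
  simp only [countVector, Finset.sum_mul]
  rw [Finset.sum_comm]
  simp

theorem ncard_eq_rk_of_isBase {E : Type*} {M : Matroid E} {B : Set E} (hB : M.IsBase B) :
    B.ncard = rk M := by
  rw [rk, ← hB.encard_eq_eRank, Set.ncard_def]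

variable {E : Type*} [Fintype E]

theorem exists_embedding_of_isBase {M : Matroid E} {B : Set E} (hB : M.IsBase B) :
    ∃ f : Fin (rk M) ↪ E, Set.range f = B := by
  classical
  have h : Fintype.card B = rk M := by
    rw [← ncard_eq_rk_of_isBase hB, ← Nat.card_coe_set_eq, Nat.card_eq_fintype_card]
  let g : B ≃ Fin (rk M) := Fintype.equivFinOfCardEq h
  exact ⟨g.symm.toEmbedding.trans (Function.Embedding.subtype _), by
    simp [Function.Embedding.trans, Set.range_comp]⟩

theorem basePolytope_eq_convexHull_range [DecidableEq E] {M : Matroid E}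
    {X : Matrix (Fin (rk M)) E ℝ} (hX : IsRealRepresentation M X) :
    basePolytope M = convexHull ℝ (Set.range
      fun f : {f : Fin (rk M) → E // (X.submatrix id f).det ≠ 0} => countVector f.1) := by
  unfold basePolytope
  congr 1
  ext x
  constructor
  · rintro ⟨B, hB, rfl⟩
    obtain ⟨f, rfl⟩ := exists_embedding_of_isBase hB
    exact ⟨⟨f, (hX.2 f).1 hB⟩, countVector_eq_indicator f.injective⟩
  · rintro ⟨⟨f, hf⟩, rfl⟩
    have hinj := injective_of_det_submatrix_ne_zero X f hf
    exact ⟨Set.range f, (hX.2 ⟨f, hinj⟩).2 hf, countVector_eq_indicator hinj⟩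

/-- Ordering the elements of `B` does not change a principal minor, so bases may be enumerated by
embeddings, as for `X`. -/
theorem isProjectionRepresentation_iff [DecidableEq E] {M : Matroid E} {T : Matrix E E ℝ} :
    IsProjectionRepresentation M T ↔ IsOrthogonalProjection T ∧
      ∀ f : Fin (rk M) ↪ E, M.IsBase (Set.range f) ↔ (T.submatrix f f).det ≠ 0 := by
  have key : ∀ (f : Fin (rk M) ↪ E) (B : Finset E), (B : Set E) = Set.range f →
      (T.submatrix (fun b : {e // e ∈ B} => (b : E)) (fun b : {e // e ∈ B} => (b : E))).det
        = (T.submatrix f f).det := by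
    intro f B hB
    have hmem : ∀ i, f i ∈ B := fun i => by
      rw [← Finset.mem_coe, hB]; exact ⟨i, rfl⟩
    let g : Fin (rk M) ≃ {e // e ∈ B} := Equiv.ofBijective (fun i => ⟨f i, hmem i⟩)
      ⟨fun i j h => f.injective (congrArg Subtype.val h), fun ⟨b, hb⟩ => by
        rw [← Finset.mem_coe, hB] at hb
        obtain ⟨i, rfl⟩ := hb
        exact ⟨i, rfl⟩⟩
    rw [← Matrix.det_submatrix_equiv_self g]
    rfl
  refine and_congr_right fun _ => ⟨fun h f => ?_, fun h B hB => ?_⟩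
  · have h1 : ((Finset.univ.map f : Finset E) : Set E) = Set.range f := by simp
    rw [← key f _ h1, ← h _ (by simp), h1]
  · let g : Fin (rk M) ≃ {e // e ∈ B} := (Fintype.equivFinOfCardEq (by simpa using hB)).symm
    have h1 : (B : Set E) = Set.range (g.toEmbedding.trans (Function.Embedding.subtype _)) := by
      simp [Function.Embedding.trans, Set.range_comp]
    rw [key _ B h1, h1]
    exact h _

/-! ### The two implications -/

theorem isStrictlyUniformlyDense_of_projectionRepresentation [DecidableEq E] [Nonempty E]
    {M : Matroid E} (hE : M.E = Set.univ) (hM : IsRealRepresentable M) {T : Matrix E E ℝ}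
    (hT : IsProjectionRepresentation M T) (hdiag : ∀ e, T e e = (density M)⁻¹) :
    IsStrictlyUniformlyDense M := by
  classical
  obtain ⟨X, hX⟩ := hM
  obtain ⟨hproj, hbase⟩ := isProjectionRepresentation_iff.1 hT
  obtain ⟨B, hB⟩ := M.exists_isBase
  obtain ⟨g, rfl⟩ := exists_embedding_of_isBase hB
  -- The rows of `T` at a base have non-singular Gram matrix, and the trace shows that they span the
  -- row space of `T`.
  set Y : Matrix (Fin (rk M)) E ℝ := T.submatrix g id with hYdef
  have hYY : Y * Yᵀ = T.submatrix g g := by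
    have h1 : Y * Yᵀ = (T * Tᵀ).submatrix g g := rfl
    rw [h1, hproj.1.eq, hproj.2]
  have hA : (Y * Yᵀ).det ≠ 0 := by
    rw [hYY]; exact (hbase g).1 hB
  have hYT : Y * T = Y := by
    have h1 : Y * T = (T * T).submatrix g id := rfl
    rw [h1, hproj.2]
  have htr : T.trace = Fintype.card (Fin (rk M)) := by
    have hn : (Fintype.card E : ℝ) ≠ 0 := by exact_mod_cast Fintype.card_ne_zero
    simp only [Matrix.trace, Matrix.diag_apply, hdiag, density, hE, Set.ncard_univ,
      Nat.card_eq_fintype_card, Finset.sum_const, Finset.card_univ, nsmul_eq_mul, inv_div,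
      Fintype.card_fin]
    field_simp
  have hTY := eq_projection_of_mul_eq T hproj Y hYT hA htr
  have hne : ∀ f : Fin (rk M) → E, (Y.submatrix id f).det ≠ 0 ↔ (X.submatrix id f).det ≠ 0 := by
    intro f
    by_cases hf : Function.Injective f
    · have h1 := hX.2 ⟨f, hf⟩
      have h2 := hbase ⟨f, hf⟩
      simp only [Function.Embedding.coeFn_mk] at h1 h2
      rw [← h1, h2, hTY, det_submatrix_projection]
      simp [hA]
    · exact iff_of_false (fun h => hf (injective_of_det_submatrix_ne_zero _ _ h))
        (fun h => hf (injective_of_det_submatrix_ne_zero _ _ h))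
  have hsum := factorial_mul_det_gram Y (fun _ => 1)
  simp only [Matrix.diagonal_one, Matrix.mul_one, Finset.prod_const_one, one_mul] at hsum
  set Z : ℝ := ((Fintype.card (Fin (rk M)))! : ℝ) * (Y * Yᵀ).det with hZ
  have hZ0 : Z ≠ 0 := mul_ne_zero (by exact_mod_cast Nat.factorial_ne_zero _) hA
  have hZpos : 0 < Z := lt_of_le_of_ne
    (hsum ▸ Finset.sum_nonneg fun f _ => sq_nonneg _) hZ0.symm
  have : Nonempty {f : Fin (rk M) → E // (X.submatrix id f).det ≠ 0} :=
    ⟨⟨g, (hX.2 g).1 hB⟩⟩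
  rw [IsStrictlyUniformlyDense, basePolytope_eq_convexHull_range hX,
    mem_intrinsicInterior_convexHull_range_iff]
  refine ⟨fun f => (Y.submatrix id f.1).det ^ 2 / Z, fun f => ?_, ?_, ?_⟩
  · exact div_pos (sq_pos_of_ne_zero ((hne f.1).2 f.2)) hZpos
  · rw [sum_subtype_eq_sum_of_ne_zero (fun f => (X.submatrix id f).det ≠ 0)
      (fun f => (Y.submatrix id f).det ^ 2 / Z) (fun f hf => (hne f).1 fun h => hf (by simp [h])),
      ← Finset.sum_div, ← hsum, div_self hZ0]
  · funext e
    simp only [Finset.sum_apply, Pi.smul_apply, smul_eq_mul]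
    rw [sum_subtype_eq_sum_of_ne_zero (fun f => (X.submatrix id f).det ≠ 0)
      (fun f => (Y.submatrix id f).det ^ 2 / Z * countVector f e)
      (fun f hf => (hne f).1 fun h => hf (by simp [h])), ← hdiag e]
    have hmarg := factorial_mul_det_mul_projection_diag Y hA e
    rw [← hTY, ← hZ] at hmarg
    rw [eq_comm, ← mul_right_inj' hZ0, hmarg, Finset.mul_sum]
    refine Finset.sum_congr rfl fun f _ => ?_
    rw [countVector]
    field_simp

theorem exists_projectionRepresentation_of_isStrictlyUniformlyDense [DecidableEq E]
    {M : Matroid E} (hM : IsRealRepresentable M) (hd : IsStrictlyUniformlyDense M) :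
    ∃ T : Matrix E E ℝ, IsProjectionRepresentation M T ∧ ∀ e : E, T e e = (density M)⁻¹ := by
  classical
  obtain ⟨X, hX⟩ := hM
  obtain ⟨B, hB⟩ := M.exists_isBase
  obtain ⟨g, rfl⟩ := exists_embedding_of_isBase hB
  have hg : (X.submatrix id g).det ≠ 0 := (hX.2 g).1 hB
  have : Nonempty {f : Fin (rk M) → E // (X.submatrix id f).det ≠ 0} := ⟨⟨g, hg⟩⟩
  rw [IsStrictlyUniformlyDense, basePolytope_eq_convexHull_range hX,
    mem_intrinsicInterior_convexHull_range_iff] at hd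
  obtain ⟨p, hp, hp1, hpc⟩ := hd
  obtain ⟨y, hy⟩ := exists_exponential_tilting _ _
    (fun f : {f : Fin (rk M) → E // (X.submatrix id f).det ≠ 0} => (X.submatrix id f.1).det ^ 2)
    p (fun f => sq_pos_of_ne_zero f.2) hp hp1 hpc
  -- The half in the exponent disappears when minors are squared.
  set Y : Matrix (Fin (rk M)) E ℝ := Matrix.of fun i e => Real.exp (y e / 2) * X i e with hYdef
  have hYdet : ∀ f : Fin (rk M) → E, (Y.submatrix id f).det
      = (∏ i, Real.exp (y (f i) / 2)) * (X.submatrix id f).det := fun f =>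
    Matrix.det_mul_row (fun i => Real.exp (y (f i) / 2)) (X.submatrix id f)
  have hYsq : ∀ f : Fin (rk M) → E, (Y.submatrix id f).det ^ 2
      = (X.submatrix id f).det ^ 2 * Real.exp (∑ e, countVector f e * y e) := by
    intro f
    rw [hYdet, mul_pow, ← Real.exp_sum, ← Real.exp_nat_mul, sum_countVector_mul, mul_comm,
      ← Finset.sum_div]
    congr 2
    push_cast
    ring
  have hYne : ∀ f : Fin (rk M) → E, (Y.submatrix id f).det ≠ 0 ↔ (X.submatrix id f).det ≠ 0 := by
    intro f
    rw [hYdet, mul_ne_zero_iff]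
    exact and_iff_right (Finset.prod_ne_zero_iff.2 fun i _ => (Real.exp_pos _).ne')
  have hsum := factorial_mul_det_gram Y (fun _ => 1)
  simp only [Matrix.diagonal_one, Matrix.mul_one, Finset.prod_const_one, one_mul] at hsum
  have hZ0 : ((Fintype.card (Fin (rk M)))! : ℝ) * (Y * Yᵀ).det ≠ 0 := by
    rw [hsum]
    exact (Finset.sum_pos' (fun (f : Fin (rk M) → E) _ => sq_nonneg (Y.submatrix id f).det)
      ⟨(g : Fin (rk M) → E), Finset.mem_univ _, sq_pos_of_ne_zero ((hYne g).2 hg)⟩).ne'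
  have hA : (Y * Yᵀ).det ≠ 0 := right_ne_zero_of_mul hZ0
  refine ⟨Yᵀ * (Y * Yᵀ)⁻¹ * Y, isProjectionRepresentation_iff.2
    ⟨isOrthogonalProjection_of_det_ne_zero Y hA, fun f => ?_⟩, fun e => ?_⟩
  · rw [hX.2 f, det_submatrix_projection, ← hYne]
    simp [hA]
  · have hmarg := factorial_mul_det_mul_projection_diag Y hA e
    have hcrit := hy e
    simp only [← hYsq] at hcrit
    -- The critical equation says that the mean of `countVector` at `e` is the inverse density;
    -- `hmarg` identifies that mean with the diagonal entry.
    rw [sum_subtype_eq_sum_of_ne_zero (fun f => (X.submatrix id f).det ≠ 0)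
      (fun f => (Y.submatrix id f).det ^ 2 * (countVector f e - (density M)⁻¹))
      (fun f hf => (hYne f).1 fun h => hf (by simp [h]))] at hcrit
    rw [← mul_right_inj' hZ0, hmarg, hsum, Finset.sum_mul, ← sub_eq_zero,
      ← Finset.sum_sub_distrib]
    refine (Finset.sum_congr rfl fun f _ => ?_).trans hcrit
    rw [countVector]
    ring

end UniformlyDense

theorem mainTheorem3 {E : Type*} [Fintype E] [DecidableEq E] [Nonempty E]
    (M : Matroid E) (hE : M.E = Set.univ) (hloop : M.Loopless)
    (hM : UniformlyDense.IsRealRepresentable M) :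
    UniformlyDense.IsStrictlyUniformlyDense M ↔
      ∃ T : Matrix E E ℝ, UniformlyDense.IsProjectionRepresentation M T ∧
        ∀ e : E, T e e = (UniformlyDense.density M)⁻¹ :=
  ⟨UniformlyDense.exists_projectionRepresentation_of_isStrictlyUniformlyDense hM,
    fun ⟨_, hT, hdiag⟩ =>
      UniformlyDense.isStrictlyUniformlyDense_of_projectionRepresentation hE hM hT hdiag⟩
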